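/- Let $(G,+)$ be a finite abelian group, let $k\ge 2$ be an integer and $\Sigma_k=\{0,\dots,k-1\}$. Let $f:\Sigma_k\times\Sigma_k\to G$ satisfy $f(0,0)=0$ and the difference condition: for all $i\ne j$ in $\Sigma_k$ and all $g\in G$, $$\#\{h\in\Sigma_k : f(i,h)-f(j,h)=g\}=\frac{k}{|G|}.$$ For $n\in\mathbb N=\{0,1,2,\dots\}$ write $n=\sum_{i\ge 0}x_i(n)k^i$ with digits $x_i(n)\in\Sigma_k$, only finitely many of them non-zero, and let $u=(u_n)_{n\ge0}$ be the generalised Rudin--Shapiro sequence $$u_n=\sum_{i\ge 0} f\bigl(x_i(n),x_{i+1}(n)\bigr)\in G .$$ Then every pattern has a frequency in $u$: for every $L\in\mathbb N$ and every word $w=w_0\cdots w_{L-1}\in G^L$ the limit $$\lim_{N\to\infty}\frac1N\,\#\{0\le n<N : u_{n+i}=w_i\text{ for all }0\le i<L\}$$ exists. Moreover, every element of $G$ has frequency $1/|G|$: for every $g\in G$, $$\lim_{N\to\infty}\frac1N\,\#\{0\le n<N : u_n=g\}=\frac1{|G|}.$$ -/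

import Mathlib

/-- The digit `x_i` (least significant digit first, padded by zeros) in the representation
`n = ∑ x_i k ^ i` of `n` in base `k`; a base is at least `2`. -/
def digit (k : ℕ) [NeZero k] (n i : ℕ) : Fin k :=
  Fin.ofNat k (n / k ^ i)

theorem digit_eq_zero {k : ℕ} [NeZero k] (hk : 2 ≤ k) {n i : ℕ} (h : n ≤ i) :
    digit k n i = 0 := by
  have h1 : n < k ^ i := lt_of_le_of_lt h (Nat.lt_pow_self (by omega))
  rw [digit, Nat.div_eq_of_lt h1]
  rfl

theorem sum_digit {k : ℕ} [NeZero k] (hk : 2 ≤ k) (n : ℕ) :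
    ∑ i ∈ Finset.range n, (digit k n i : ℕ) * k ^ i = n := by
  have key : ∀ m, ∑ i ∈ Finset.range m, (digit k n i : ℕ) * k ^ i = n % k ^ m := by
    intro m
    induction m with
    | zero => simp [Nat.mod_one]
    | succ m ih =>
      rw [Finset.sum_range_succ, ih, Nat.mod_pow_succ, mul_comm]
      rfl
  rw [key, Nat.mod_eq_of_lt (Nat.lt_pow_self (by omega))]

/-- `u` is the block-additive sequence (of rank 2) in base `k` of weight function `f`. -/
structure IsBlockAdditive {G : Type*} [AddCommGroup G] (k : ℕ) [NeZero k]
    (f : Fin k → Fin k → G) (u : ℕ → G) : Prop where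
  map_zero_zero : f 0 0 = 0
  eq_sum : ∀ n, u n = ∑ᶠ i : ℕ, f (digit k n i) (digit k n (i + 1))

/-- In base `k ≥ 2` the sum defining a block-additive sequence has finitely many nonzero terms. -/
theorem blockAdditive_support_finite {G : Type*} [AddCommGroup G] {k : ℕ} [NeZero k] (hk : 2 ≤ k)
    {f : Fin k → Fin k → G} (hf : f 0 0 = 0) (n : ℕ) :
    (Function.support fun i : ℕ => f (digit k n i) (digit k n (i + 1))).Finite := by
  refine (Set.finite_lt_nat n).subset fun i hi => ?_
  by_contra h
  have h' : n ≤ i := not_lt.mp h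
  exact hi (by simp [digit_eq_zero hk h', digit_eq_zero hk (Nat.le_succ_of_le h'), hf])

/-- The difference condition: for two distinct rows `i`, `j`, the difference
`d i h - d j h` takes each value `g` for exactly `k / |G|` columns `h` (an exact quotient). -/
def IsDifferenceMatrix {G : Type*} [AddCommGroup G] (k : ℕ) (d : Fin k → Fin k → G) : Prop :=
  ∀ i j : Fin k, i ≠ j → ∀ g : G,
    (Nat.card {h : Fin k // d i h - d j h = g} : ℚ) = (k : ℚ) / (Nat.card G : ℚ)

/-- `u` is a generalised Rudin–Shapiro sequence in base `k`. -/
def IsGeneralisedRudinShapiro {G : Type*} [AddCommGroup G] (k : ℕ) [NeZero k]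
    (u : ℕ → G) : Prop :=
  ∃ f : Fin k → Fin k → G, IsBlockAdditive k f u ∧ IsDifferenceMatrix k f

/-- The pattern `w` (a finite word of length `L`) occurs in `u` at position `n`. -/
def OccursAt {A : Type*} (u : ℕ → A) {L : ℕ} (w : Fin L → A) (n : ℕ) : Prop :=
  ∀ i : Fin L, u (n + i) = w i

open Classical in
/-- The pattern `w` has frequency `α` in `u`: the proportion of positions `n < N` at which `w`
occurs tends to `α` as `N → ∞`. -/
def HasFrequency {A : Type*} (u : ℕ → A) {L : ℕ} (w : Fin L → A) (α : ℝ) : Prop :=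
  Filter.Tendsto
    (fun N : ℕ => (((Finset.range N).filter fun n => OccursAt u w n).card : ℝ) / (N : ℝ))
    Filter.atTop (nhds α)

/-! Appending base-`k` digits to `q` changes `u` by an amount depending on `q` only through its last
digit. Hence blocks of length `k ^ m` over `q` and `q'` with equal last digit and `u q = u q'`
contain a pattern equally often, up to `L` windows crossing the end of a block. The difference
condition makes the states (last digit, value of `u`) mix: for some `K = k ^ r`, every block of
length `K` meets every state (`exists_forall_block`). Cut two blocks of length `K ^ (t + 1)` into
`K` pieces each; one pair of pieces can be matched, so the discrepancy satisfies `D (t + 1) ≤ (K -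
1) * D t + L` and is `o(K ^ t)` (`blockCount_sub_le`). Block densities therefore become uniform and
frequencies exist. Comparing states whose values differ by `c` shows that frequencies are invariant
under translation, so all letters are equally frequent. -/

/-! ### Block counts and densities. -/

section Counting

open Classical in
/-- The number of `s < b` such that `p (b * q + s)`. -/
noncomputable def blockCount (p : ℕ → Prop) (b q : ℕ) : ℕ :=
  Nat.count (fun s => p (b * q + s)) b

open Classical in
theorem count_add_mul (p : ℕ → Prop) (a b Q : ℕ) :
    Nat.count (fun s => p (a + s)) (b * Q) =
      ∑ j ∈ Finset.range Q, Nat.count (fun s => p (a + b * j + s)) b := by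
  induction Q with
  | zero => simp
  | succ Q ih =>
    rw [Nat.mul_succ, Nat.count_add, ih, Finset.sum_range_succ]
    simp only [add_assoc]

open Classical in
theorem blockCount_mul (p : ℕ → Prop) (b K q : ℕ) :
    blockCount p (b * K) q = ∑ j : Fin K, blockCount p b (K * q + j) := by
  rw [blockCount, count_add_mul, ← Fin.sum_univ_eq_sum_range
    (fun j => Nat.count (fun s => p (b * K * q + b * j + s)) b)]
  refine Finset.sum_congr rfl fun j _ => ?_
  simp only [blockCount, mul_add, mul_assoc]

theorem blockCount_le (p : ℕ → Prop) (b q : ℕ) : blockCount p b q ≤ b := by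
  classical exact Nat.count_le _

open Classical in
theorem count_block_mul (p : ℕ → Prop) (b Q : ℕ) :
    Nat.count p (b * Q) = ∑ j ∈ Finset.range Q, blockCount p b j := by
  simpa [blockCount] using count_add_mul p 0 b Q

open Classical in
/-- If the counts in all blocks of length `b` are close to each other, then the densities of long
initial segments are close to the density of any block. -/
theorem abs_density_sub_blockCount_le {p : ℕ → Prop} {b : ℕ} (hb : 0 < b) {ε : ℝ}
    (h : ∀ q q', |(blockCount p b q : ℝ) - blockCount p b q'| ≤ ε * b) (q : ℕ) {N : ℕ}
    (hN : 0 < N) :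
    |(Nat.count p N : ℝ) / N - (blockCount p b q : ℝ) / b| ≤ ε + b / N := by
  have hε : 0 ≤ ε * b := (abs_nonneg _).trans (h q q)
  obtain ⟨R, Q, hR, rfl⟩ : ∃ R Q, R < b ∧ N = b * Q + R :=
    ⟨N % b, N / b, Nat.mod_lt _ hb, (Nat.div_add_mod N b).symm⟩
  set c : ℝ := (blockCount p b q : ℝ)
  have hc0 : 0 ≤ c := Nat.cast_nonneg _
  have hcb : c ≤ b := Nat.cast_le.2 (blockCount_le p b q)
  obtain ⟨e, heR, he⟩ : ∃ e : ℕ, e ≤ R ∧ Nat.count p (b * Q + R) = Nat.count p (b * Q) + e :=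
    ⟨_, Nat.count_le _, Nat.count_add _ _ _⟩
  have hsum : |(Nat.count p (b * Q) : ℝ) - Q * c| ≤ Q * (ε * b) := by
    have : (Nat.count p (b * Q) : ℝ) - Q * c =
        ∑ j ∈ Finset.range Q, ((blockCount p b j : ℝ) - c) := by
      rw [count_block_mul]; simp
    rw [this]
    refine (Finset.abs_sum_le_sum_abs _ _).trans ((Finset.sum_le_sum fun j _ => h j q).trans ?_)
    simp
  have hbR : (0 : ℝ) < b := by exact_mod_cast hb
  have hNR : (0 : ℝ) < ((b * Q + R : ℕ) : ℝ) := by exact_mod_cast hN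
  have he0 : (0 : ℝ) ≤ e := Nat.cast_nonneg _
  have heR' : (e : ℝ) ≤ R := by exact_mod_cast heR
  have hRb : (R : ℝ) ≤ b := by exact_mod_cast hR.le
  have hR0 : (0 : ℝ) ≤ R := Nat.cast_nonneg _
  rw [div_sub_div _ _ hNR.ne' hbR.ne', abs_div, abs_of_pos (mul_pos hNR hbR),
    div_le_iff₀ (mul_pos hNR hbR), add_mul, ← mul_assoc (_ / _), div_mul_cancel₀ _ hNR.ne', he]
  have h1 : ((Nat.count p (b * Q) + e : ℕ) : ℝ) * b - ((b * Q + R : ℕ) : ℝ) * c =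
      b * ((Nat.count p (b * Q) : ℝ) - Q * c) + (b * e - R * c) := by
    push_cast; ring
  have h2 : |(b : ℝ) * e - R * c| ≤ b * b := by
    rw [abs_le]
    constructor
    · nlinarith [mul_le_mul hRb hcb hc0 hbR.le, mul_nonneg hbR.le he0]
    · nlinarith [mul_nonneg hR0 hc0, mul_le_mul_of_nonneg_left (heR'.trans hRb) hbR.le]
  rw [h1]
  refine (abs_add_le _ _).trans (add_le_add ?_ h2)
  rw [abs_mul, abs_of_pos hbR]
  calc (b : ℝ) * _ ≤ b * (Q * (ε * b)) := mul_le_mul_of_nonneg_left hsum hbR.le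
    _ = (b * Q) * (ε * b) := by ring
    _ ≤ ((b * Q + R : ℕ) : ℝ) * (ε * b) := by
        refine mul_le_mul_of_nonneg_right ?_ hε
        push_cast; linarith
    _ = _ := by ring

open Classical in
/-- Asymptotically equal block densities force the density to exist. -/
theorem exists_tendsto_density {p : ℕ → Prop}
    (h : ∀ ε > (0 : ℝ), ∃ b > 0, ∀ q q',
      |(blockCount p b q : ℝ) - blockCount p b q'| ≤ ε * b) :
    ∃ α : ℝ, Filter.Tendsto (fun N : ℕ => (Nat.count p N : ℝ) / N) Filter.atTop (nhds α) := by
  refine cauchySeq_tendsto_of_complete (Metric.cauchySeq_iff'.2 fun ε hε => ?_)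
  -- Two densities are each compared with block `0`, at a cost of `ε / 8 + ε / 8` each.
  obtain ⟨b, hb, hbq⟩ := h (ε / 8) (by positivity)
  have hlim : Filter.Tendsto (fun N : ℕ => (b : ℝ) / N) Filter.atTop (nhds 0) :=
    tendsto_const_div_atTop_nhds_zero_nat _
  obtain ⟨M, hM⟩ := Filter.eventually_atTop.1
    ((hlim.eventually (gt_mem_nhds (by positivity : (0 : ℝ) < ε / 8))).and
      (Filter.eventually_gt_atTop 0))
  refine ⟨M, fun n hn => ?_⟩
  have h1 := abs_le.1 (abs_density_sub_blockCount_le hb hbq 0 (hM n hn).2)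
  have h2 := abs_le.1 (abs_density_sub_blockCount_le hb hbq 0 (hM M le_rfl).2)
  have h3 := (hM n hn).1
  have h4 := (hM M le_rfl).1
  rw [Real.dist_eq, abs_lt]
  constructor <;> linarith

open Classical in
theorem abs_limit_sub_blockCount_le {p : ℕ → Prop} {α : ℝ}
    (hα : Filter.Tendsto (fun N : ℕ => (Nat.count p N : ℝ) / N) Filter.atTop (nhds α))
    {b : ℕ} (hb : 0 < b) {ε : ℝ}
    (h : ∀ q q', |(blockCount p b q : ℝ) - blockCount p b q'| ≤ ε * b) (q : ℕ) :
    |α - (blockCount p b q : ℝ) / b| ≤ ε := by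
  have hlim : Filter.Tendsto (fun N : ℕ => ε + (b : ℝ) / N) Filter.atTop (nhds (ε + 0)) :=
    tendsto_const_nhds.add (tendsto_const_div_atTop_nhds_zero_nat _)
  rw [add_zero] at hlim
  refine le_of_tendsto_of_tendsto (hα.sub_const _).abs hlim ?_
  filter_upwards [Filter.eventually_gt_atTop 0] with N hN
  exact abs_density_sub_blockCount_le hb h q hN

-- The loss `L` pays for the last `L` positions, where a window of length `L` may leave the block.
open Classical in
theorem count_le_count_add {p p' : ℕ → Prop} {b L : ℕ}
    (h : ∀ s, s + L ≤ b → p s → p' s) : Nat.count p b ≤ Nat.count p' b + L := by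
  have h1 : Nat.count p (b - L) ≤ Nat.count p' (b - L) := by
    rcases le_total L b with hL | hL
    · rw [Nat.count_eq_card_filter_range, Nat.count_eq_card_filter_range]
      refine Finset.card_le_card fun s hs => ?_
      simp only [Finset.mem_filter, Finset.mem_range] at hs ⊢
      exact ⟨hs.1, h s (by omega) hs.2⟩
    · simp [Nat.sub_eq_zero_of_le hL]
  calc Nat.count p b ≤ Nat.count p (b - L + L) := Nat.count_monotone _ (by omega)
    _ ≤ Nat.count p (b - L) + L := by
        rw [Nat.count_add]; exact Nat.add_le_add_left (Nat.count_le _) _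
    _ ≤ Nat.count p' b + L :=
        Nat.add_le_add_right (h1.trans (Nat.count_monotone _ (by omega))) _

/-- Two sums over the same index type are compared by matching one good pair of indices. -/
theorem sum_sub_sum_le_of_pair {K : ℕ} (F F' : Fin K → ℝ) {B L : ℝ} (i j : Fin K)
    (hij : F i - F' j ≤ L) (hB : ∀ i j, F i - F' j ≤ B) :
    ∑ i, F i - ∑ j, F' j ≤ (K - 1) * B + L := by
  -- Reindexing by the transposition pairs `i` with `j`; the other `K - 1` pairs cost `B` each.
  rw [← Equiv.sum_comp (Equiv.swap i j) F', ← Finset.sum_sub_distrib,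
    ← Finset.add_sum_erase _ _ (Finset.mem_univ i), Equiv.swap_apply_left, add_comm]
  refine add_le_add ((Finset.sum_le_card_nsmul _ _ B fun x _ => hB _ _).trans_eq ?_) hij
  have : 1 ≤ K := i.pos
  rw [Finset.card_erase_of_mem (Finset.mem_univ i), nsmul_eq_mul]
  simp [Nat.cast_sub this]

end Counting

/-! ### Digit recursion for block-additive sequences. -/

section BlockAdditive

variable {G : Type*} [AddCommGroup G] {k : ℕ} [NeZero k] {f : Fin k → Fin k → G} {u : ℕ → G}

theorem digit_mul_add_zero (n : ℕ) (a : Fin k) : digit k (k * n + a) 0 = a := by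
  ext
  simp [digit, Fin.ofNat, Nat.mod_eq_of_lt a.isLt]

theorem digit_mul_add_succ (n : ℕ) (a : Fin k) (i : ℕ) :
    digit k (k * n + a) (i + 1) = digit k n i := by
  have hk : 0 < k := Nat.pos_of_ne_zero (NeZero.ne k)
  rw [digit, digit, pow_succ', ← Nat.div_div_eq_div_mul, Nat.mul_add_div hk,
    Nat.div_eq_of_lt a.isLt, add_zero]

namespace IsBlockAdditive

theorem eq_sum_range (hu : IsBlockAdditive k f u) (hk : 2 ≤ k) {n M : ℕ} (h : n ≤ M) :
    u n = ∑ i ∈ Finset.range M, f (digit k n i) (digit k n (i + 1)) := by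
  rw [hu.eq_sum n]
  refine finsum_eq_sum_of_support_subset _ fun i hi => ?_
  by_contra hM
  have h' : n ≤ i := h.trans (by simpa using hM)
  exact hi (by simp [digit_eq_zero hk h', digit_eq_zero hk (Nat.le_succ_of_le h'),
    hu.map_zero_zero])

theorem apply_mul_add (hu : IsBlockAdditive k f u) (hk : 2 ≤ k) (n : ℕ) (a : Fin k) :
    u (k * n + a) = f a (Fin.ofNat k n) + u n := by
  have hn : n ≤ k * n + a := (Nat.le_mul_of_pos_left n (by omega)).trans (Nat.le_add_right _ _)
  rw [hu.eq_sum_range hk (Nat.le_succ (k * n + a)), Finset.sum_range_succ', add_comm,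
    hu.eq_sum_range hk hn]
  simp only [digit_mul_add_zero, digit_mul_add_succ]
  simp [digit]

/-- The increment from `q` to `k ^ m * q + s` depends on `q` only through its last digit. -/
theorem apply_pow_mul_add (hu : IsBlockAdditive k f u) (hk : 2 ≤ k) {q q' : ℕ}
    (hq : q ≡ q' [MOD k]) (m : ℕ) {s : ℕ} (hs : s < k ^ m) :
    u (k ^ m * q + s) + u q' = u (k ^ m * q' + s) + u q := by
  induction m generalizing s with
  | zero =>
    obtain rfl : s = 0 := by simpa using hs
    simp [add_comm]
  | succ m ih =>
    have hs' : s / k < k ^ m := Nat.div_lt_of_lt_mul (by rwa [pow_succ'] at hs)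
    have key : ∀ x, k ^ (m + 1) * x + s =
        k * (k ^ m * x + s / k) + (⟨s % k, Nat.mod_lt _ (by omega)⟩ : Fin k) := by
      intro x
      conv_lhs => rw [← Nat.div_add_mod s k]
      simp only
      ring
    have hcol : Fin.ofNat k (k ^ m * q + s / k) = Fin.ofNat k (k ^ m * q' + s / k) :=
      Fin.ext ((hq.mul_left _).add_right _)
    rw [key, key, hu.apply_mul_add hk, hu.apply_mul_add hk, hcol, add_assoc, ih hs', add_assoc]

/-! ### Return weights and mixing of states. -/

/-- The increments of `u` that are realised between any `q` divisible by `k` and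
some `n` divisible by `k` with `n / k ^ r = q`. -/
def returnWeights (k : ℕ) (u : ℕ → G) (r : ℕ) : Set G :=
  {g | ∀ q, k ∣ q → ∃ n, n / k ^ r = q ∧ k ∣ n ∧ u n = u q + g}

theorem add_mem_returnWeights {G : Type*} [AddCommGroup G] {k : ℕ} {u : ℕ → G} {r s : ℕ} {g h : G} (hg : g ∈ returnWeights k u r)
    (hh : h ∈ returnWeights k u s) : g + h ∈ returnWeights k u (r + s) := by
  intro q hq
  obtain ⟨n, hn, hkn, hun⟩ := hg q hq
  obtain ⟨n', hn', hkn', hun'⟩ := hh n hkn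
  exact ⟨n', by rw [add_comm r, pow_add, ← Nat.div_div_eq_div_mul, hn', hn], hkn',
    by rw [hun', hun, add_assoc]⟩

/-- Appending zeros after a final zero costs nothing; this later pads return paths to a common
length. -/
theorem zero_mem_returnWeights (hu : IsBlockAdditive k f u) (hk : 2 ≤ k) (r : ℕ) :
    (0 : G) ∈ returnWeights k u r := by
  induction r with
  | zero => exact fun q hq => ⟨q, by simp, hq, by simp⟩
  | succ r ih =>
    have h1 : (0 : G) ∈ returnWeights k u 1 := fun q hq =>
      ⟨k * q + (0 : Fin k), by simp [Nat.mul_div_cancel_left q (show 0 < k by omega)], by simp,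
        by
          have : Fin.ofNat k q = 0 := Fin.ext (by simpa using Nat.mod_eq_zero_of_dvd hq)
          rw [hu.apply_mul_add hk, this, hu.map_zero_zero, zero_add, add_zero]⟩
    simpa using add_mem_returnWeights ih h1

theorem ofNat_mul_add (n : ℕ) (a : Fin k) : Fin.ofNat k (k * n + a) = a := by
  ext; simp [Fin.ofNat, Nat.mod_eq_of_lt a.isLt]

theorem mul_add_div_self {k : ℕ} (hk : 2 ≤ k) (n : ℕ) (a : Fin k) : (k * n + a) / k = n := by
  rw [Nat.mul_add_div (by omega), Nat.div_eq_of_lt a.isLt, add_zero]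

/-- The path of last digits `0 → a → b → 0`. -/
theorem cycle_mem_returnWeights (hu : IsBlockAdditive k f u) (hk : 2 ≤ k) (a b : Fin k) :
    f a 0 + f b a + f 0 b ∈ returnWeights k u 3 := by
  intro q hq
  have h0 : Fin.ofNat k q = 0 := Fin.ext (by simpa using Nat.mod_eq_zero_of_dvd hq)
  refine ⟨k * (k * (k * q + a) + b) + (0 : Fin k), ?_, by simp, ?_⟩
  · rw [pow_succ, pow_two, ← Nat.div_div_eq_div_mul, ← Nat.div_div_eq_div_mul,
      mul_add_div_self hk, mul_add_div_self hk, mul_add_div_self hk]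
  · rw [hu.apply_mul_add hk, hu.apply_mul_add hk, hu.apply_mul_add hk, ofNat_mul_add,
      ofNat_mul_add, h0]
    abel

/-- The group elements occurring as return weights form a subgroup. -/
def returnSubgroup [Finite G] (hu : IsBlockAdditive k f u) (hk : 2 ≤ k) : AddSubgroup G where
  carrier := {g | ∃ r, g ∈ returnWeights k u r}
  zero_mem' := ⟨0, hu.zero_mem_returnWeights hk 0⟩
  add_mem' := fun ⟨_, hr⟩ ⟨_, hs⟩ => ⟨_, add_mem_returnWeights hr hs⟩
  neg_mem' := by
    rintro g ⟨r, hr⟩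
    have hmul : ∀ m : ℕ, ∃ r, m • g ∈ returnWeights k u r := by
      intro m
      induction m with
      | zero => exact ⟨0, by simpa using hu.zero_mem_returnWeights hk 0⟩
      | succ m ih =>
        obtain ⟨s, hs⟩ := ih
        exact ⟨s + r, by rw [succ_nsmul]; exact add_mem_returnWeights hs hr⟩
    -- Paths cannot be reversed, but in a finite group a negative is a natural multiple.
    have hneg : -g = (addOrderOf g - 1) • g := by
      rw [neg_eq_iff_add_eq_zero, ← succ_nsmul', Nat.sub_add_cancel (addOrderOf_pos g),
        addOrderOf_nsmul_eq_zero]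
    rw [hneg]
    exact hmul _

/-- Modulo `T` the cycles force `f b a = f b 0 - f a 0`, so the difference of rows `1` and `0` is
constant modulo `T`. Since that difference takes every value in `G`, `T` is everything. -/
theorem returnSubgroup_eq_top [Finite G] (hu : IsBlockAdditive k f u) (hk : 2 ≤ k)
    (hf : IsDifferenceMatrix k f) : hu.returnSubgroup hk = ⊤ := by
  set T := hu.returnSubgroup hk
  have hcyc : ∀ a b, f a 0 + f b a + f 0 b ∈ T := fun a b =>
    ⟨3, hu.cycle_mem_returnWeights hk a b⟩
  have hpot : ∀ a b, f b a - f b 0 + f a 0 ∈ T := fun a b => by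
    have h := T.sub_mem (hcyc a b) (hcyc b 0)
    rw [hu.map_zero_zero] at h
    convert h using 1
    abel
  rw [eq_top_iff]
  intro g _
  let i : Fin k := ⟨1, by omega⟩
  have hi : i ≠ 0 := by
    intro h
    have := congrArg Fin.val h
    simp [i] at this
  -- The shift by `f i 0` cancels the constant value of the row difference modulo `T`.
  have hcard := hf i 0 hi (g + f i 0)
  have hpos : (0 : ℚ) < (k : ℚ) / (Nat.card G : ℚ) := by
    have : 0 < Nat.card G := Nat.card_pos
    have : 0 < k := by omega
    positivity
  rw [← hcard, Nat.cast_pos] at hpos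
  obtain ⟨⟨h, hh⟩⟩ := (Nat.card_pos_iff.1 hpos).1
  have := T.sub_mem (hpot h i) (hpot h 0)
  rw [hu.map_zero_zero] at this
  convert this using 1
  rw [← add_sub_cancel_right g (f i 0), ← hh]
  abel

/-- Some power `k ^ r` is such that every `k ^ r`-adic block of indices realises every pair of a
last digit and a value of `u`. -/
theorem exists_forall_block [Finite G] (hu : IsBlockAdditive k f u) (hk : 2 ≤ k)
    (hf : IsDifferenceMatrix k f) :
    ∃ r ≠ 0, ∀ (q b : ℕ) (g : G), ∃ n, n / k ^ r = q ∧ n ≡ b [MOD k] ∧ u n = g := by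
  have hall : ∀ g : G, ∃ r, g ∈ returnWeights k u r := fun g => by
    have : g ∈ hu.returnSubgroup hk := by rw [hu.returnSubgroup_eq_top hk hf]; trivial
    exact this
  choose ρ hρ using hall
  obtain ⟨R, hR⟩ := (Set.finite_range ρ).bddAbove
  have hRall : ∀ g : G, g ∈ returnWeights k u R := fun g => by
    have := add_mem_returnWeights (hρ g)
      (hu.zero_mem_returnWeights hk (R - ρ g))
    rwa [add_zero, Nat.add_sub_cancel' (hR ⟨g, rfl⟩)] at this
  -- Two extra digits: a zero before the return path, so that it starts at a multiple of `k`, and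
  -- the prescribed digit after it.
  refine ⟨R + 2, by omega, fun q b g => ?_⟩
  let β : Fin k := Fin.ofNat k b
  obtain ⟨n, hn, hkn, hun⟩ := hRall (g - f β 0 - u (k * q)) (k * q) (dvd_mul_right _ _)
  have h0 : Fin.ofNat k n = 0 := Fin.ext (by simpa using Nat.mod_eq_zero_of_dvd hkn)
  refine ⟨k * n + β, ?_, ?_, ?_⟩
  · rw [show k ^ (R + 2) = k * k ^ R * k by ring, ← Nat.div_div_eq_div_mul,
      ← Nat.div_div_eq_div_mul, mul_add_div_self hk, hn, Nat.mul_div_cancel_left _ (by omega)]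
  · simp [Nat.ModEq, β]
  · rw [hu.apply_mul_add hk, h0, hun]
    abel

/-! ### Comparison of pattern counts between blocks. -/

theorem occursAt_of_modEq (hu : IsBlockAdditive k f u) (hk : 2 ≤ k) {L : ℕ} (w : Fin L → G)
    {q q' : ℕ} (hq : q ≡ q' [MOD k]) (m : ℕ) {s : ℕ} (hs : s + L ≤ k ^ m)
    (h : OccursAt u w (k ^ m * q + s)) :
    OccursAt u (fun i => w i + (u q' - u q)) (k ^ m * q' + s) := by
  intro i
  have h1 := hu.apply_pow_mul_add hk hq m (s := s + i) (by omega)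
  rw [← add_assoc, ← add_assoc, h i] at h1
  simp only
  rw [← add_sub_assoc, h1, add_sub_cancel_right]

theorem blockCount_le_add (hu : IsBlockAdditive k f u) (hk : 2 ≤ k) {L : ℕ} (w : Fin L → G)
    {q q' : ℕ} (hq : q ≡ q' [MOD k]) (m : ℕ) :
    blockCount (OccursAt u w) (k ^ m) q ≤
      blockCount (OccursAt u fun i => w i + (u q' - u q)) (k ^ m) q' + L :=
  count_le_count_add fun _ hs h => hu.occursAt_of_modEq hk w hq m hs h

/-- The factor `1 + L * t` absorbs the boundary loss `L` of each of the `t` subdivisions. -/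
theorem blockCount_sub_le (hu : IsBlockAdditive k f u) (hk : 2 ≤ k) {r : ℕ} (hr0 : r ≠ 0)
    (hr : ∀ (q b : ℕ) (g : G), ∃ n, n / k ^ r = q ∧ n ≡ b [MOD k] ∧ u n = g)
    {L : ℕ} (w : Fin L → G) (t q q' : ℕ) :
    (blockCount (OccursAt u w) ((k ^ r) ^ t) q : ℝ) -
        blockCount (OccursAt u w) ((k ^ r) ^ t) q' ≤
      (1 + L * t) * ((k ^ r : ℕ) - 1 : ℝ) ^ t := by
  set K := k ^ r with hK
  have hK2 : 2 ≤ K := hk.trans (Nat.le_self_pow hr0 k)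
  have hK1 : (1 : ℝ) ≤ (K : ℝ) - 1 := by
    have : (2 : ℝ) ≤ K := by exact_mod_cast hK2
    linarith
  induction t generalizing q q' with
  | zero =>
    have h1 : (blockCount (OccursAt u w) (K ^ 0) q : ℝ) ≤ 1 := by
      exact_mod_cast blockCount_le (OccursAt u w) (K ^ 0) q
    have h2 : (0 : ℝ) ≤ blockCount (OccursAt u w) (K ^ 0) q' := Nat.cast_nonneg _
    simp only [Nat.cast_zero, mul_zero, add_zero, pow_zero, mul_one] at h1 h2 ⊢
    linarith
  | succ t ih =>
    -- Some child `n` of `q` has the same state as the first child `K * q'` of `q'`.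
    obtain ⟨n, hn, hmod, hun⟩ := hr q (K * q') (u (K * q'))
    have hn' : K * q + n % K = n := by rw [← hn]; exact Nat.div_add_mod n K
    have hpair := hu.blockCount_le_add hk w hmod (r * t)
    rw [hun, pow_mul, ← hK] at hpair
    simp only [sub_self, add_zero] at hpair
    rw [pow_succ, blockCount_mul, blockCount_mul]
    push_cast
    refine (sum_sub_sum_le_of_pair _ _ (L := L) ⟨n % K, Nat.mod_lt _ (by omega)⟩ ⟨0, by omega⟩ ?_
      fun i j => ih (K * q + i) (K * q' + j)).trans ?_
    · simp only [hn', add_zero]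
      rw [sub_le_iff_le_add']
      exact_mod_cast hpair
    · have h1 : (1 : ℝ) ≤ ((K : ℝ) - 1) ^ (t + 1) := one_le_pow₀ hK1
      have hL : (0 : ℝ) ≤ L := Nat.cast_nonneg _
      have h2 := mul_le_mul_of_nonneg_left h1 hL
      calc ((K : ℝ) - 1) * ((1 + L * t) * (K - 1) ^ t) + L
          = (1 + L * t) * (K - 1) ^ (t + 1) + L * 1 := by ring
        _ ≤ (1 + L * t) * (K - 1) ^ (t + 1) + L * (K - 1) ^ (t + 1) := by linarith
        _ = _ := by ring

/-- The counts of a pattern in the `k`-adic blocks of suitable large lengths are asymptotically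
equal. -/
theorem exists_blockCount_close [Finite G] (hu : IsBlockAdditive k f u) (hk : 2 ≤ k)
    (hf : IsDifferenceMatrix k f) {L : ℕ} {ε : ℝ} (hε : 0 < ε) :
    ∃ m, (L : ℝ) ≤ ε * (k ^ m : ℕ) ∧ ∀ (w : Fin L → G) (q q' : ℕ),
      |(blockCount (OccursAt u w) (k ^ m) q : ℝ) - blockCount (OccursAt u w) (k ^ m) q'| ≤
        ε * (k ^ m : ℕ) := by
  obtain ⟨r, hr0, hr⟩ := hu.exists_forall_block hk hf
  set K : ℝ := ((k ^ r : ℕ) : ℝ) with hK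
  have hK2 : 2 ≤ K := by
    rw [hK]
    exact_mod_cast hk.trans (Nat.le_self_pow hr0 k)
  have hK0 : 0 < K := by linarith
  set x : ℝ := (K - 1) / K with hx
  have hx0 : 0 ≤ x := div_nonneg (by linarith) hK0.le
  have hx1 : x < 1 := by rw [hx, div_lt_one hK0]; linarith
  have hlim : Filter.Tendsto (fun t : ℕ => x ^ t + L * (t * x ^ t)) Filter.atTop (nhds 0) := by
    simpa using (tendsto_pow_atTop_nhds_zero_of_lt_one hx0 hx1).add
      ((tendsto_self_mul_const_pow_of_lt_one hx0 hx1).const_mul (L : ℝ))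
  obtain ⟨t, ht, ht0⟩ :=
    -- Positivity of `t` gives `L ≤ 1 + L * t`, so the same bound controls the boundary loss.
    ((hlim.eventually (gt_mem_nhds hε)).and (Filter.eventually_gt_atTop 0)).exists
  have hpow : ((k ^ (r * t) : ℕ) : ℝ) = K ^ t := by
    rw [hK, pow_mul]
    push_cast
    ring
  have hbound : (1 + L * t) * (K - 1) ^ t ≤ ε * K ^ t := by
    have hxt : x ^ t * K ^ t = (K - 1) ^ t := by
      rw [← mul_pow, hx, div_mul_cancel₀ _ hK0.ne']
    calc (1 + L * t) * (K - 1) ^ t = (x ^ t + L * (t * x ^ t)) * K ^ t := by rw [← hxt]; ring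
      _ ≤ ε * K ^ t := mul_le_mul_of_nonneg_right ht.le (pow_nonneg hK0.le _)
  refine ⟨r * t, ?_, fun w q q' => ?_⟩
  · rw [hpow]
    refine le_trans ?_ hbound
    have h1 : (1 : ℝ) ≤ (K - 1) ^ t := one_le_pow₀ (by linarith)
    have h2 : (1 : ℝ) ≤ t := by exact_mod_cast ht0
    have hL : (0 : ℝ) ≤ L := Nat.cast_nonneg _
    have h3 : (L : ℝ) ≤ 1 + L * t := by nlinarith
    nlinarith
  · rw [hpow, abs_sub_le_iff, pow_mul]
    exact ⟨(hu.blockCount_sub_le hk hr0 hr w t q q').trans hbound,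
      (hu.blockCount_sub_le hk hr0 hr w t q' q).trans hbound⟩

end IsBlockAdditive

end BlockAdditive

/-! ### Existence and translation invariance of frequencies. -/

section Frequency

open Classical in
theorem hasFrequency_iff_count {A : Type*} {u : ℕ → A} {L : ℕ} {w : Fin L → A} {α : ℝ} :
    HasFrequency u w α ↔
      Filter.Tendsto (fun N : ℕ => (Nat.count (OccursAt u w) N : ℝ) / N) Filter.atTop
        (nhds α) := by
  simp only [HasFrequency, Nat.count_eq_card_filter_range]

variable {G : Type*} [AddCommGroup G] [Finite G] {k : ℕ} [NeZero k] {f : Fin k → Fin k → G}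
  {u : ℕ → G}

namespace IsBlockAdditive

theorem exists_hasFrequency (hu : IsBlockAdditive k f u) (hk : 2 ≤ k)
    (hf : IsDifferenceMatrix k f) {L : ℕ} (w : Fin L → G) : ∃ α, HasFrequency u w α := by
  simp only [hasFrequency_iff_count]
  refine exists_tendsto_density fun ε hε => ?_
  obtain ⟨m, -, hm⟩ := hu.exists_blockCount_close hk hf (L := L) hε
  exact ⟨k ^ m, pow_pos (by omega) m, hm w⟩

/-- The frequency of a pattern is at most that of any of its translates. -/
theorem frequency_le_frequency_add (hu : IsBlockAdditive k f u) (hk : 2 ≤ k)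
    (hf : IsDifferenceMatrix k f) {L : ℕ} {w : Fin L → G} {c : G} {α β : ℝ}
    (hα : HasFrequency u w α) (hβ : HasFrequency u (fun i => w i + c) β) : α ≤ β := by
  rw [hasFrequency_iff_count] at hα hβ
  refine le_of_forall_pos_le_add fun ε hε => ?_
  obtain ⟨m, hL, hm⟩ := hu.exists_blockCount_close hk hf (L := L) (ε := ε / 3) (by positivity)
  obtain ⟨r, -, hr⟩ := hu.exists_forall_block hk hf
  -- A block over this `q` is the block over `0` translated by `c`.
  obtain ⟨q, -, hmod, hq⟩ := hr 0 0 (u 0 + c)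
  have hb : 0 < k ^ m := pow_pos (by omega) m
  have hbR : (0 : ℝ) < (k ^ m : ℕ) := by exact_mod_cast hb
  have h1 := (abs_le.1 (abs_limit_sub_blockCount_le hα hb (hm w) 0)).2
  have h2 := (abs_le.1 (abs_limit_sub_blockCount_le hβ hb (hm _) q)).1
  have h3 := hu.blockCount_le_add hk w hmod.symm m
  rw [hq, add_sub_cancel_left] at h3
  have h4 : (blockCount (OccursAt u w) (k ^ m) 0 : ℝ) / (k ^ m : ℕ) ≤
      (blockCount (OccursAt u fun i => w i + c) (k ^ m) q : ℝ) / (k ^ m : ℕ) + ε / 3 := by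
    rw [div_add' _ _ _ hbR.ne']
    refine div_le_div_of_nonneg_right ?_ hbR.le
    refine le_trans ?_ (add_le_add_right hL _)
    exact_mod_cast h3
  linarith

/-- Any two letters are translates of each other, so their frequencies agree; they sum to `1`. -/
theorem hasFrequency_letter (hu : IsBlockAdditive k f u) (hk : 2 ≤ k)
    (hf : IsDifferenceMatrix k f) (g : G) :
    HasFrequency u (fun _ : Fin 1 => g) (1 / (Nat.card G : ℝ)) := by
  classical
  have := Fintype.ofFinite G
  choose α hα using fun g : G => hu.exists_hasFrequency hk hf (fun _ : Fin 1 => g)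
  have hle : ∀ g h, α g ≤ α h := fun g h =>
    hu.frequency_le_frequency_add hk hf (c := h - g) (hα g) (by simpa using hα h)
  have hsum : ∑ h, α h = 1 := by
    refine tendsto_nhds_unique
      (tendsto_finsetSum Finset.univ fun h _ => hasFrequency_iff_count.1 (hα h)) ?_
    refine tendsto_const_nhds.congr' ?_
    filter_upwards [Filter.eventually_gt_atTop 0] with N hN
    have hN' : (N : ℝ) ≠ 0 := by exact_mod_cast hN.ne'
    rw [← Finset.sum_div, eq_comm, div_eq_one_iff_eq hN', ← Nat.cast_sum]
    congr 1
    have := Finset.card_eq_sum_card_fiberwise (f := u) (s := Finset.range N)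
      (t := Finset.univ) fun _ _ => Finset.mem_coe.2 (Finset.mem_univ _)
    rw [Finset.card_range] at this
    refine Eq.trans ?_ this.symm
    refine Finset.sum_congr rfl fun h _ => ?_
    rw [Nat.count_eq_card_filter_range]
    simp [OccursAt]
  have hconst : ∀ h, α h = α g := fun h => le_antisymm (hle h g) (hle g h)
  simp only [hconst, Finset.sum_const, Finset.card_univ, nsmul_eq_mul] at hsum
  have hα' := hα g
  rwa [eq_one_div_of_mul_eq_one_right hsum, ← Nat.card_eq_fintype_card] at hα'

end IsBlockAdditive

end Frequency

theorem mainTheorem6 {G : Type*} [AddCommGroup G] [Finite G] (k : ℕ) [NeZero k] (hk : 2 ≤ k)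
    (u : ℕ → G) (hu : IsGeneralisedRudinShapiro k u) :
    (∀ (L : ℕ) (w : Fin L → G), ∃ α : ℝ, HasFrequency u w α) ∧
      ∀ g : G, HasFrequency u (fun _ : Fin 1 => g) (1 / (Nat.card G : ℝ)) := by
  obtain ⟨f, hu, hf⟩ := hu
  exact ⟨fun _ w => hu.exists_hasFrequency hk hf w, hu.hasFrequency_letter hk hf⟩
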